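/- Let $q$ be an odd prime power, let $f\in\mathbb F_q[x]$ be irreducible of degree $d$, and let $N$ be the curve $y^2=x f(x)^2$ over $\mathbb F_q$. Let $\mathrm{Jac}(N)$ be its generalized Jacobian, that is, the ideal class group (invertible fractional ideals modulo principal ones) of the coordinate ring $\mathbb F_q[x,y]/(y^2-xf(x)^2)$. A Mumford pair $[u,v]$ on $N$ is a pair of polynomials $u,v\in\mathbb F_q[x]$ with $\deg v<\deg u$ and $u\mid xf^2-v^2$, such that for every multiple root $a\in\overline{\mathbb F}_q$ of $xf^2$ with $u(a)=v(a)=0$ the quotient $(xf^2-v^2)/u$ does not vanish at $a$. It represents a class $D\in\mathrm{Jac}(N)$ if the ideal $(u(x),\,y-v(x))$ is invertible and $D$ is the class of this ideal. Call $h\in\mathbb F_q[x]$ admissible if $\deg h<d$ and $\gcd(f(x),x-h(x)^2)=1$. Then: 1. for every admissible $h$, $[f^2,hf]$ is a Mumford pair that represents exactly one class of $\mathrm{Jac}(N)$, and this class is not the identity; 2. every class $D\in\mathrm{Jac}(N)$ other than the identity is represented by $[f^2,hf]$ for exactly one admissible $h$; 3. the identity class is represented by the pair $[1,0]$. So the elements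 of $\mathrm{Jac}(N)$ other than the identity correspond bijectively to the admissible polynomials $h$. -/

import Mathlib

open Polynomial
open scoped nonZeroDivisors

namespace NodalCurve

/-- The right-hand side `x f(x)²` of the equation of the curve `N : y² = x f(x)²`. -/
noncomputable def rhs {F : Type*} [Field F] (f : F[X]) : F[X] := X * f ^ 2

/-- The defining polynomial `Y² - x f(x)²` of `N`, as a polynomial in `Y` over `F[x]`. -/
noncomputable def equation {F : Type*} [Field F] (f : F[X]) : F[X][X] := X ^ 2 - C (rhs f)

theorem irreducible_equation {F : Type*} [Field F] (f : F[X]) (hf : f ≠ 0) :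
    Irreducible (equation f) := by
  have hdeg : (equation f).natDegree = 2 := natDegree_X_pow_sub_C
  have hmon : (equation f).Monic := monic_X_pow_sub_C _ two_ne_zero
  rw [hmon.irreducible_iff_roots_eq_zero_of_degree_le_three (by omega) (by omega),
    Multiset.eq_zero_iff_forall_notMem]
  intro r hr
  have hroot : r ^ 2 = X * f ^ 2 := by
    have h := (mem_roots'.mp hr).2
    simp only [equation, rhs, IsRoot.def, eval_sub, eval_pow, eval_X, eval_C] at h
    exact sub_eq_zero.mp h
  have h := congrArg natDegree hroot
  rw [natDegree_mul X_ne_zero (pow_ne_zero _ hf), natDegree_pow, natDegree_pow,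
    natDegree_X] at h
  omega

/-- The coordinate ring `F[x, y] / (y² - x f(x)²)` of the (affine) curve `N`. -/
abbrev CoordinateRing {F : Type*} [Field F] (f : F[X]) : Type _ := AdjoinRoot (equation f)

instance isDomain_coordinateRing {F : Type*} [Field F] (f : F[X]) [hf : Fact (Irreducible f)] :
    IsDomain (CoordinateRing f) :=
  AdjoinRoot.isDomain_of_prime (irreducible_equation f hf.out.ne_zero).prime

/-- The (generalized) Jacobian of `N`: the ideal class group of its coordinate ring, i.e. the
invertible fractional ideals modulo the principal ones. The group is written multiplicatively, so
that its identity is `1`. -/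
abbrev Jac {F : Type*} [Field F] (f : F[X]) [Fact (Irreducible f)] : Type _ :=
  ClassGroup (CoordinateRing f)

/-- `[u, v]` satisfies the Mumford conditions on `N`: `deg v < deg u`; `u` divides
`x f² - v²`; and, at every singular point `(a, 0)` (`a` a multiple root of `x f²` in the algebraic
closure) at which both `u` and `v` vanish, `(x f² - v²) / u` does not vanish. -/
def IsMumfordPair {F : Type*} [Field F] (f u v : F[X]) : Prop :=
  v.degree < u.degree ∧
  ∃ w : F[X], rhs f - v ^ 2 = u * w ∧
    ∀ a : AlgebraicClosure F,
      1 < ((rhs f).map (algebraMap F (AlgebraicClosure F))).rootMultiplicity a →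
      aeval a u = 0 → aeval a v = 0 → aeval a w ≠ 0

/-- The ideal `(u(x), y - v(x))` of the coordinate ring attached to the pair `[u, v]`. -/
noncomputable def mumfordIdeal {F : Type*} [Field F] (f u v : F[X]) : Ideal (CoordinateRing f) :=
  Ideal.span {AdjoinRoot.of (equation f) u,
    AdjoinRoot.root (equation f) - AdjoinRoot.of (equation f) v}

/-- The class `D` in the Jacobian is represented by the Mumford pair `[u, v]`: the pair satisfies
the Mumford conditions, its ideal `(u, y - v)` is invertible, and `D` is the class of
that ideal. -/
def Represents {F : Type*} [Field F] (f : F[X]) [Fact (Irreducible f)] (u v : F[X])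
    (D : Jac f) : Prop :=
  IsMumfordPair f u v ∧
  ∃ I : (FractionalIdeal (CoordinateRing f)⁰ (FractionRing (CoordinateRing f)))ˣ,
    (I : FractionalIdeal (CoordinateRing f)⁰ (FractionRing (CoordinateRing f))) =
      (mumfordIdeal f u v : FractionalIdeal (CoordinateRing f)⁰ (FractionRing (CoordinateRing f)))
    ∧ ClassGroup.mk (FractionRing (CoordinateRing f)) I = D

end NodalCurve

/-!
The normalization of `N` is the line with coordinate `t`, where `x = t²` and `y = t f(t²)`. It
embeds the coordinate ring `R` into `F[t]` as the polynomials `a(t²) + t f(t²) b(t²)`, a subring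
whose conductor is `f(t²) F[t]`. As `F[t]` is principal, an ideal class of `R` is determined by
how an `R`-submodule of `F[t]` sits modulo the conductor, that is, by a line in the plane
`F[t] / (f(t²))` over the field `F[x] / (f)`. The line through `1` is the identity, and every other
line is spanned by `t - h` for exactly one `h` modulo `f`; invertibility says that `t - h` is a unit
modulo `f(t²)`, which amounts to `gcd(f, x - h²) = 1`.

The ideal `(f², y - h f)` becomes `f · (F[x] f + F[x] (t - h))` in `F[t]`
(`mem_mumfordIdeal_iff`). It is invertible because its product with the conjugate ideal is `(f²)`
(`mumfordIdeal_mul_mumfordIdeal_neg`). For admissible `h` it extends to the ideal `(f(t²))` of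
`F[t]`, whatever `h` is (`map_normalization_mumfordIdeal`), so that an equivalence between two such
ideals is an equality up to a constant; hence it is not principal (`not_mumfordIdeal_eq_span`) and
its class determines `h` (`eq_of_span_mul_mumfordIdeal_eq`). Conversely, an invertible ideal `I`
extends to some `(g)`, and the lattice `g⁻¹ I` contains the conductor, generates the unit ideal of
`F[t]`, and is not all of `F[t]`, which leaves only the lines above
(`principal_or_exists_admissible`).
-/

/-! ### Integral representatives of ideal classes -/

section ClassGroupRepresentatives

variable {R : Type*} [CommRing R] [IsDomain R]

theorem exists_unit_eq_coeIdeal_of_mul_eq_span {I J : Ideal R} {c : R} (hc : c ≠ 0)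
    (h : I * J = Ideal.span {c}) :
    ∃ K : (FractionalIdeal R⁰ (FractionRing R))ˣ,
      (K : FractionalIdeal R⁰ (FractionRing R)) = (I : FractionalIdeal R⁰ (FractionRing R)) := by
  have hc' : algebraMap R (FractionRing R) c ≠ 0 :=
    (map_ne_zero_iff _ (IsFractionRing.injective R (FractionRing R))).mpr hc
  have hunit : IsUnit ((I : FractionalIdeal R⁰ (FractionRing R)) *
      ((J : FractionalIdeal R⁰ (FractionRing R)) *
        FractionalIdeal.spanSingleton R⁰ (algebraMap R (FractionRing R) c)⁻¹)) := by
    rw [← mul_assoc, ← FractionalIdeal.coeIdeal_mul, h, FractionalIdeal.coeIdeal_span_singleton,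
      FractionalIdeal.spanSingleton_mul_spanSingleton, mul_inv_cancel₀ hc',
      FractionalIdeal.spanSingleton_one]
    exact isUnit_one
  exact isUnit_of_mul_isUnit_left hunit

/-- Clearing denominators in an invertible fractional ideal and in its inverse: every ideal class
contains an integral ideal `I` with a cofactor `J` making `I * J` principal. -/
theorem exists_coeIdeal_of_class (D : ClassGroup R) :
    ∃ (K : (FractionalIdeal R⁰ (FractionRing R))ˣ) (I J : Ideal R) (c : R), c ≠ 0 ∧
      (K : FractionalIdeal R⁰ (FractionRing R)) = (I : FractionalIdeal R⁰ (FractionRing R)) ∧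
      ClassGroup.mk (FractionRing R) K = D ∧ I * J = Ideal.span {c} := by
  obtain ⟨K, rfl⟩ : ∃ K, ClassGroup.mk (FractionRing R) K = D :=
    ClassGroup.induction (FractionRing R) (fun K => ⟨K, rfl⟩) D
  obtain ⟨a, I, ha, hI⟩ := FractionalIdeal.exists_eq_spanSingleton_mul
    (K : FractionalIdeal R⁰ (FractionRing R))
  obtain ⟨b, J, hb, hJ⟩ := FractionalIdeal.exists_eq_spanSingleton_mul
    ((K⁻¹ : (FractionalIdeal R⁰ (FractionRing R))ˣ) : FractionalIdeal R⁰ (FractionRing R))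
  have ha' : algebraMap R (FractionRing R) a ≠ 0 :=
    (map_ne_zero_iff _ (IsFractionRing.injective R (FractionRing R))).mpr ha
  have hb' : algebraMap R (FractionRing R) b ≠ 0 :=
    (map_ne_zero_iff _ (IsFractionRing.injective R (FractionRing R))).mpr hb
  have hI' : (I : FractionalIdeal R⁰ (FractionRing R)) =
      FractionalIdeal.spanSingleton R⁰ (algebraMap R (FractionRing R) a) * K := by
    rw [hI, ← mul_assoc, FractionalIdeal.spanSingleton_mul_spanSingleton, mul_inv_cancel₀ ha',
      FractionalIdeal.spanSingleton_one, one_mul]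
  have hJ' : (J : FractionalIdeal R⁰ (FractionRing R)) =
      FractionalIdeal.spanSingleton R⁰ (algebraMap R (FractionRing R) b) *
        ((K⁻¹ : (FractionalIdeal R⁰ (FractionRing R))ˣ) :
          FractionalIdeal R⁰ (FractionRing R)) := by
    rw [hJ, ← mul_assoc, FractionalIdeal.spanSingleton_mul_spanSingleton, mul_inv_cancel₀ hb',
      FractionalIdeal.spanSingleton_one, one_mul]
  refine ⟨K * toPrincipalIdeal R (FractionRing R) (Units.mk0 _ ha'), I, J, a * b,
    mul_ne_zero ha hb, ?_, ?_, ?_⟩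
  · rw [hI', Units.val_mul, coe_toPrincipalIdeal, mul_comm, Units.val_mk0]
  · exact (ClassGroup.mk_eq_mk.mpr ⟨_, rfl⟩).symm
  · apply FractionalIdeal.coeIdeal_injective (K := FractionRing R)
    change ((I * J : Ideal R) : FractionalIdeal R⁰ (FractionRing R)) = _
    rw [FractionalIdeal.coeIdeal_mul, hI', hJ', mul_mul_mul_comm, Units.mul_inv, mul_one,
      FractionalIdeal.spanSingleton_mul_spanSingleton, ← map_mul,
      ← FractionalIdeal.coeIdeal_span_singleton]

end ClassGroupRepresentatives

/-! ### Even and odd parts of a polynomial -/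

section EvenOdd

variable {F : Type*} [Field F]

theorem exists_expand_add_X_mul_expand (P : F[X]) :
    ∃ a b : F[X], P = expand F 2 a + X * expand F 2 b := by
  induction P using Polynomial.induction_on' with
  | add p q hp hq =>
    obtain ⟨a, b, rfl⟩ := hp
    obtain ⟨a', b', rfl⟩ := hq
    exact ⟨a + a', b + b', by simp only [map_add]; ring⟩
  | monomial n c =>
    obtain ⟨k, rfl | rfl⟩ := n.even_or_odd'
    · exact ⟨monomial k c, 0, by simp [expand_monomial, mul_comm]⟩
    · refine ⟨0, monomial k c, ?_⟩
      rw [map_zero, zero_add, expand_monomial, X_mul_monomial, mul_comm]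

theorem expand_add_X_mul_expand_inj {a b a' b' : F[X]}
    (h : expand F 2 a + X * expand F 2 b = expand F 2 a' + X * expand F 2 b') :
    a = a' ∧ b = b' := by
  have key : ∀ (p q : F[X]) (n : ℕ), (expand F 2 p + X * expand F 2 q).coeff (2 * n) = p.coeff n ∧
      (expand F 2 p + X * expand F 2 q).coeff (2 * n + 1) = q.coeff n := by
    intro p q n
    constructor
    · rw [coeff_add, coeff_expand_mul' two_pos]
      cases n with
      | zero => simp
      | succ n =>
        rw [show 2 * (n + 1) = (2 * n + 1) + 1 by ring, coeff_X_mul, coeff_expand two_pos,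
          if_neg (by omega), add_zero]
    · rw [coeff_add, coeff_X_mul, coeff_expand_mul' two_pos, coeff_expand two_pos,
        if_neg (by omega), zero_add]
  constructor <;> ext n
  · rw [← (key a b n).1, h, (key a' b' n).1]
  · rw [← (key a b n).2, h, (key a' b' n).2]

theorem expand_dvd_expand_add {f a b : F[X]} (ha : f ∣ a) (hb : f ∣ b) :
    expand F 2 f ∣ expand F 2 a + X * expand F 2 b := by
  obtain ⟨a, rfl⟩ := ha
  obtain ⟨b, rfl⟩ := hb
  exact ⟨expand F 2 a + X * expand F 2 b, by simp only [map_mul]; ring⟩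

end EvenOdd

namespace NodalCurve

variable {F : Type*} [Field F]

/-! ### The normalization of the curve -/

/-- The normalization `F[x, y] / (y² - x f(x)²) → F[t]` of the curve `N`, given by `x = t²` and
`y = t f(t²)`. Here `expand F 2` is the substitution of `t²` for `x`. -/
noncomputable def normalization (f : F[X]) : CoordinateRing f →+* F[X] :=
  AdjoinRoot.lift (expand F 2 : F[X] →+* F[X]) (X * expand F 2 f) (by
    simp only [equation, eval₂_sub, eval₂_X_pow, eval₂_C]
    simp only [rhs, RingHom.coe_coe, map_mul, map_pow, expand_X]
    ring)

@[simp] theorem normalization_of (f p : F[X]) :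
    normalization f (AdjoinRoot.of (equation f) p) = expand F 2 p :=
  AdjoinRoot.lift_of _

@[simp] theorem normalization_root (f : F[X]) :
    normalization f (AdjoinRoot.root (equation f)) = X * expand F 2 f :=
  AdjoinRoot.lift_root _

theorem root_sq (f : F[X]) :
    AdjoinRoot.root (equation f) ^ 2 = AdjoinRoot.of (equation f) (X * f ^ 2) := by
  have h : eval₂ (AdjoinRoot.of (equation f)) (AdjoinRoot.root (equation f))
      (X ^ 2 - C (rhs f)) = 0 := AdjoinRoot.eval₂_root (equation f)
  rwa [eval₂_sub, eval₂_X_pow, eval₂_C, sub_eq_zero] at h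

theorem exists_of_add_root_mul_of {f : F[X]} (r : CoordinateRing f) :
    ∃ a b : F[X], r = AdjoinRoot.of (equation f) a +
      AdjoinRoot.root (equation f) * AdjoinRoot.of (equation f) b := by
  induction r using AdjoinRoot.induction_on with
  | ih p =>
    induction p using Polynomial.induction_on with
    | C a => exact ⟨a, 0, by simp⟩
    | add p q hp hq =>
      obtain ⟨a, b, hp⟩ := hp
      obtain ⟨a', b', hq⟩ := hq
      exact ⟨a + a', b + b', by rw [map_add, hp, hq]; simp only [map_add]; ring⟩
    | monomial n c h =>
      obtain ⟨a, b, h⟩ := h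
      refine ⟨X * f ^ 2 * b, a, ?_⟩
      rw [pow_succ, ← mul_assoc, map_mul, h, AdjoinRoot.mk_X, map_mul _ (X * f ^ 2) b, ← root_sq]
      ring

theorem exists_normalization_eq {f : F[X]} (r : CoordinateRing f) :
    ∃ a b : F[X], normalization f r = expand F 2 a + X * expand F 2 (f * b) := by
  obtain ⟨a, b, rfl⟩ := exists_of_add_root_mul_of r
  exact ⟨a, b, by simp only [map_add, map_mul, normalization_of, normalization_root]; ring⟩

theorem mem_range_normalization {f a b : F[X]} :
    expand F 2 a + X * expand F 2 b ∈ (normalization f).range ↔ f ∣ b := by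
  constructor
  · rintro ⟨r, hr⟩
    obtain ⟨a', b', h⟩ := exists_normalization_eq r
    exact ⟨b', (expand_add_X_mul_expand_inj (hr.symm.trans h)).2⟩
  · rintro ⟨b, rfl⟩
    refine ⟨AdjoinRoot.of (equation f) a +
      AdjoinRoot.root (equation f) * AdjoinRoot.of (equation f) b, ?_⟩
    simp only [map_add, map_mul, normalization_of, normalization_root]
    ring

/-- The conductor: multiples of `f(t²)` in `F[t]` come from the coordinate ring. -/
theorem expand_mul_mem_range_normalization (f P : F[X]) :
    expand F 2 f * P ∈ (normalization f).range := by
  obtain ⟨a, b, rfl⟩ := exists_expand_add_X_mul_expand P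
  have h : expand F 2 f * (expand F 2 a + X * expand F 2 b) =
      expand F 2 (f * a) + X * expand F 2 (f * b) := by
    simp only [map_mul]
    ring
  rw [h, mem_range_normalization]
  exact dvd_mul_right f b

theorem normalization_injective {f : F[X]} (hf : f ≠ 0) :
    Function.Injective (normalization f) := by
  rw [injective_iff_map_eq_zero]
  intro r hr
  obtain ⟨a, b, rfl⟩ := exists_of_add_root_mul_of r
  have h : expand F 2 a + X * expand F 2 (f * b) = expand F 2 0 + X * expand F 2 0 := by
    simp only [map_add, map_mul, normalization_of, normalization_root] at hr
    simp only [map_mul, map_zero, mul_zero, add_zero]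
    rw [← hr]
    ring
  obtain ⟨rfl, hb⟩ := expand_add_X_mul_expand_inj h
  obtain rfl := (mul_eq_zero.mp hb).resolve_left hf
  simp

theorem expand_ne_zero {f : F[X]} (hf : f ≠ 0) : expand F 2 f ≠ 0 :=
  (map_ne_zero_iff _ (expand_injective two_pos)).mpr hf

/-! ### The ideals `(f², y - h f)` -/

theorem X_sub_expand_dvd (h : F[X]) : X - expand F 2 h ∣ expand F 2 (X - h ^ 2) :=
  ⟨X + expand F 2 h, by simp only [map_sub, map_pow, expand_X]; ring⟩

/-- Since `x - h² = (t - h)(t + h)`, admissibility of `h` makes `f` and `t - h` coprime in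
`F[t]`. -/
theorem isCoprime_expand {f h : F[X]} (hh : IsCoprime f (X - h ^ 2)) :
    IsCoprime (expand F 2 f) (X - expand F 2 h) :=
  IsCoprime.of_isCoprime_of_dvd_right (hh.map (expand F 2 : F[X] →+* F[X])) (X_sub_expand_dvd h)

theorem isCoprime_of_isCoprime_expand {f h : F[X]} (hf : Irreducible f)
    (hh : IsCoprime (expand F 2 f) (X - expand F 2 h)) : IsCoprime f (X - h ^ 2) := by
  rw [hf.coprime_iff_not_dvd]
  intro hdvd
  have h1 : expand F 2 f ∣ (X - expand F 2 h) * (X + expand F 2 h) := by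
    have := map_dvd (expand F 2) hdvd
    simp only [map_sub, map_pow, expand_X] at this
    convert this using 1
    ring
  obtain ⟨P, hP⟩ := hh.dvd_of_dvd_mul_left h1
  obtain ⟨a, b, rfl⟩ := exists_expand_add_X_mul_expand P
  have h2 : expand F 2 h + X * expand F 2 1 = expand F 2 (f * a) + X * expand F 2 (f * b) := by
    simp only [map_mul, map_one, mul_one]
    rw [add_comm, hP]
    ring
  exact hf.not_isUnit (IsUnit.of_mul_eq_one _ (expand_add_X_mul_expand_inj h2).2.symm)

/-- In `F[t]`, the ideal `(f², y - h f)` becomes `f` times the lattice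
`F[x] f + F[x] (t - h)`. -/
theorem mem_mumfordIdeal_iff {f : F[X]} (hf : f ≠ 0) (h : F[X]) {z : CoordinateRing f} :
    z ∈ mumfordIdeal f (f ^ 2) (h * f) ↔ ∃ p q : F[X], normalization f z =
      expand F 2 f * (expand F 2 p * expand F 2 f + expand F 2 q * (X - expand F 2 h)) := by
  rw [mumfordIdeal, Ideal.mem_span_pair]
  constructor
  · rintro ⟨r, s, rfl⟩
    obtain ⟨a, b, rfl⟩ := exists_of_add_root_mul_of r
    obtain ⟨c, e, rfl⟩ := exists_of_add_root_mul_of s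
    refine ⟨a + X * e + f * b * h - e * h ^ 2, f ^ 2 * b + c - f * e * h, ?_⟩
    simp only [map_add, map_sub, map_mul, map_pow, normalization_of, normalization_root, expand_X]
    ring
  · rintro ⟨p, q, hz⟩
    refine ⟨AdjoinRoot.of (equation f) p, AdjoinRoot.of (equation f) q, ?_⟩
    apply normalization_injective hf
    rw [hz]
    simp only [map_add, map_sub, map_mul, map_pow, normalization_of, normalization_root]
    ring

theorem map_normalization_mumfordIdeal {f h : F[X]} (hh : IsCoprime f (X - h ^ 2)) :
    (mumfordIdeal f (f ^ 2) (h * f)).map (normalization f) = Ideal.span {expand F 2 f} := by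
  rw [mumfordIdeal, Ideal.map_span, Set.image_pair]
  apply le_antisymm
  · rw [Ideal.span_le, Set.pair_subset_iff]
    simp only [SetLike.mem_coe, Ideal.mem_span_singleton, map_sub, map_mul, map_pow,
      normalization_of, normalization_root]
    exact ⟨dvd_pow_self _ two_ne_zero, ⟨X - expand F 2 h, by ring⟩⟩
  · rw [Ideal.span_singleton_le_iff_mem, Ideal.mem_span_pair]
    obtain ⟨u, v, huv⟩ := isCoprime_expand hh
    refine ⟨u, v, ?_⟩
    simp only [map_sub, map_mul, map_pow, normalization_of, normalization_root]
    linear_combination expand F 2 f * huv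

theorem mumfordIdeal_mul_mumfordIdeal_neg {f h : F[X]} (hh : IsCoprime f (X - h ^ 2)) :
    mumfordIdeal f (f ^ 2) (h * f) * mumfordIdeal f (f ^ 2) (-h * f) =
      Ideal.span {AdjoinRoot.of (equation f) (f ^ 2)} := by
  have hroot := root_sq f
  apply le_antisymm
  · rw [mumfordIdeal, mumfordIdeal, Ideal.span_pair_mul_span_pair, Ideal.span_le]
    intro z hz
    simp only [Set.mem_insert_iff, Set.mem_singleton_iff] at hz
    rw [SetLike.mem_coe, Ideal.mem_span_singleton]
    rcases hz with rfl | rfl | rfl | rfl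
    · exact dvd_mul_right _ _
    · exact dvd_mul_right _ _
    · exact dvd_mul_left _ _
    · refine ⟨AdjoinRoot.of (equation f) (X - h ^ 2), ?_⟩
      simp only [map_mul, map_pow, map_neg, map_sub] at hroot ⊢
      linear_combination hroot
  · rw [Ideal.span_singleton_le_iff_mem]
    obtain ⟨u, v, huv⟩ := hh.pow_left (m := 2)
    have h1 : AdjoinRoot.of (equation f) (f ^ 2) ∈ mumfordIdeal f (f ^ 2) (h * f) :=
      Ideal.subset_span (Set.mem_insert _ _)
    have h2 : AdjoinRoot.of (equation f) (f ^ 2) ∈ mumfordIdeal f (f ^ 2) (-h * f) :=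
      Ideal.subset_span (Set.mem_insert _ _)
    have h3 : AdjoinRoot.root (equation f) - AdjoinRoot.of (equation f) (h * f) ∈
        mumfordIdeal f (f ^ 2) (h * f) :=
      Ideal.subset_span (Set.mem_insert_of_mem _ rfl)
    have h4 : AdjoinRoot.root (equation f) - AdjoinRoot.of (equation f) (-h * f) ∈
        mumfordIdeal f (f ^ 2) (-h * f) :=
      Ideal.subset_span (Set.mem_insert_of_mem _ rfl)
    have key := add_mem
      (Ideal.mul_mem_left _ (AdjoinRoot.of (equation f) u) (Ideal.mul_mem_mul h1 h2))
      (Ideal.mul_mem_left _ (AdjoinRoot.of (equation f) v) (Ideal.mul_mem_mul h3 h4))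
    convert key using 1
    have huv' := congrArg (AdjoinRoot.of (equation f)) huv
    simp only [map_mul, map_pow, map_neg, map_sub, map_add, map_one] at hroot huv' ⊢
    linear_combination -(AdjoinRoot.of (equation f) f) ^ 2 * huv' -
      AdjoinRoot.of (equation f) v * hroot

theorem isMumfordPair_of_isCoprime {f h : F[X]} (hf : f ≠ 0) (hdeg : h.degree < f.natDegree)
    (hh : IsCoprime f (X - h ^ 2)) : IsMumfordPair f (f ^ 2) (h * f) := by
  refine ⟨?_, X - h ^ 2, by rw [rhs]; ring, ?_⟩
  · rw [pow_two]
    rw [← degree_eq_natDegree hf] at hdeg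
    rw [degree_mul, degree_mul]
    exact WithBot.add_lt_add_right (degree_ne_bot.mpr hf) hdeg
  · intro a _ hu _ hw
    obtain ⟨u, v, huv⟩ := hh
    have h0 : aeval a f = 0 := by simpa using hu
    have := congrArg (aeval a) huv
    simp only [map_add, map_mul, h0, hw, mul_zero, add_zero, map_one] at this
    exact zero_ne_one this

theorem not_mumfordIdeal_eq_span {f h : F[X]} (hf : Irreducible f)
    (hh : IsCoprime f (X - h ^ 2)) (x : CoordinateRing f) :
    mumfordIdeal f (f ^ 2) (h * f) ≠ Ideal.span {x} := by
  intro heq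
  have hmap := map_normalization_mumfordIdeal hh
  rw [heq, Ideal.map_span, Set.image_singleton, Ideal.span_singleton_eq_span_singleton] at hmap
  obtain ⟨u, hu⟩ := hmap.symm
  -- The generator is `f(t²)` up to a constant, so `t - h` would come from the coordinate ring.
  obtain ⟨c, -, hc⟩ := Polynomial.isUnit_iff.mp u.isUnit
  have hmem : AdjoinRoot.root (equation f) - AdjoinRoot.of (equation f) (h * f) ∈
      Ideal.span {x} := heq ▸ Ideal.subset_span (Set.mem_insert_of_mem _ rfl)
  obtain ⟨r, hr⟩ := Ideal.mem_span_singleton.mp hmem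
  have hr' := congrArg (normalization f) hr
  rw [map_mul (normalization f) x r, ← hu, ← hc] at hr'
  simp only [map_sub, map_mul, normalization_of, normalization_root] at hr'
  have h1 : X - expand F 2 h = C c * normalization f r :=
    mul_left_cancel₀ (expand_ne_zero hf.ne_zero) (by linear_combination hr')
  have h2 : expand F 2 (-h) + X * expand F 2 1 ∈ (normalization f).range := by
    refine ⟨AdjoinRoot.of (equation f) (C c) * r, ?_⟩
    rw [map_mul, normalization_of, expand_C, ← h1, map_neg, map_one]
    ring
  exact hf.not_isUnit (isUnit_of_dvd_one (mem_range_normalization.mp h2))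

theorem eq_of_span_mul_mumfordIdeal_eq {f h k : F[X]} (hf : f ≠ 0)
    (hhdeg : h.degree < f.natDegree) (hkdeg : k.degree < f.natDegree)
    (hh : IsCoprime f (X - h ^ 2)) (hk : IsCoprime f (X - k ^ 2)) {x y : CoordinateRing f}
    (hx : x ≠ 0) (heq : Ideal.span {x} * mumfordIdeal f (f ^ 2) (h * f) =
      Ideal.span {y} * mumfordIdeal f (f ^ 2) (k * f)) : h = k := by
  have hf' := expand_ne_zero hf
  have hx' : normalization f x ≠ 0 :=
    (map_ne_zero_iff _ (normalization_injective hf)).mpr hx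
  have hmap := congrArg (Ideal.map (normalization f)) heq
  rw [Ideal.map_mul, Ideal.map_mul, map_normalization_mumfordIdeal hh,
    map_normalization_mumfordIdeal hk, Ideal.map_span, Ideal.map_span, Set.image_singleton,
    Set.image_singleton, Ideal.span_singleton_mul_span_singleton,
    Ideal.span_singleton_mul_span_singleton, Ideal.span_singleton_eq_span_singleton] at hmap
  obtain ⟨u, hu⟩ := hmap
  obtain ⟨c, -, hc⟩ := Polynomial.isUnit_iff.mp u.isUnit
  rw [← hc] at hu
  have hxy : normalization f y = normalization f x * C c :=
    mul_right_cancel₀ hf' (by linear_combination -hu)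
  have hmem : y * (AdjoinRoot.root (equation f) - AdjoinRoot.of (equation f) (k * f)) ∈
      Ideal.span {x} * mumfordIdeal f (f ^ 2) (h * f) := by
    rw [heq]
    exact Ideal.mul_mem_mul (Ideal.mem_span_singleton_self y)
      (Ideal.subset_span (Set.mem_insert_of_mem _ rfl))
  obtain ⟨z, hz, hxz⟩ := Ideal.mem_span_singleton_mul.mp hmem
  obtain ⟨p, q, hpq⟩ := (mem_mumfordIdeal_iff hf h).mp hz
  have h1 := congrArg (normalization f) hxz
  rw [map_mul, map_mul, hxy, hpq] at h1
  simp only [map_sub, map_mul, normalization_of, normalization_root] at h1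
  have h2 : C c * (X - expand F 2 k) =
      expand F 2 p * expand F 2 f + expand F 2 q * (X - expand F 2 h) :=
    mul_left_cancel₀ (mul_ne_zero hx' hf') (by linear_combination -h1)
  have h3 : expand F 2 (-(C c * k)) + X * expand F 2 (C c) =
      expand F 2 (p * f - q * h) + X * expand F 2 q := by
    simp only [map_neg, map_sub, map_mul, expand_C]
    linear_combination h2
  obtain ⟨h4, rfl⟩ := expand_add_X_mul_expand_inj h3
  have hc0 : C c ≠ 0 := hc ▸ u.ne_zero
  have hdvd : f ∣ C c * (h - k) := ⟨p, by linear_combination h4⟩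
  have hdvd' : f ∣ h - k := (hc ▸ u.isUnit : IsUnit (C c)).dvd_mul_left.mp hdvd
  refine sub_eq_zero.mp (eq_zero_of_dvd_of_degree_lt hdvd' ?_)
  rw [degree_eq_natDegree hf]
  exact (degree_sub_le h k).trans_lt (max_lt hhdeg hkdeg)

/-! ### Lattices of invertible ideals -/

/-- The lattice `g⁻¹ I` in `F[t]`, of interest when `g` generates the extension of `I` to `F[t]`.
Membership is stated without division. -/
def lattice (f : F[X]) (I : Ideal (CoordinateRing f)) (g : F[X]) : AddSubgroup F[X] where
  carrier := {j | ∃ z ∈ I, normalization f z = g * j}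
  add_mem' := by
    rintro j k ⟨z, hz, hzj⟩ ⟨w, hw, hwk⟩
    exact ⟨z + w, add_mem hz hw, by rw [map_add, hzj, hwk, mul_add]⟩
  zero_mem' := ⟨0, zero_mem _, by simp⟩
  neg_mem' := by
    rintro j ⟨z, hz, hzj⟩
    exact ⟨-z, neg_mem hz, by rw [map_neg, hzj, mul_neg]⟩

theorem normalization_mul_mem_lattice {f g j : F[X]} {I : Ideal (CoordinateRing f)}
    (r : CoordinateRing f) (hj : j ∈ lattice f I g) : normalization f r * j ∈ lattice f I g := by
  obtain ⟨z, hz, hzj⟩ := hj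
  exact ⟨r * z, I.mul_mem_left r hz, by rw [map_mul, hzj]; ring⟩

theorem expand_mul_mem_lattice {f g j : F[X]} {I : Ideal (CoordinateRing f)}
    (p : F[X]) (hj : j ∈ lattice f I g) : expand F 2 p * j ∈ lattice f I g := by
  rw [← normalization_of f p]
  exact normalization_mul_mem_lattice _ hj

/-- The conductor of the coordinate ring absorbs the extension of `I` to `F[t]` into `I`. -/
theorem conductor_mul_mem_lattice {f g : F[X]} {I : Ideal (CoordinateRing f)}
    (hg : I.map (normalization f) = Ideal.span {g}) (P : F[X]) :
    expand F 2 f * P ∈ lattice f I g := by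
  have key : ∀ w ∈ I.map (normalization f), ∀ s : F[X],
      ∃ z ∈ I, normalization f z = expand F 2 f * s * w := by
    intro w hw
    rw [Ideal.map] at hw
    induction hw using Submodule.span_induction with
    | mem w hw =>
      obtain ⟨z, hz, rfl⟩ := hw
      intro s
      obtain ⟨r, hr⟩ := expand_mul_mem_range_normalization f s
      exact ⟨r * z, I.mul_mem_left r hz, by rw [map_mul, hr]⟩
    | zero => exact fun s => ⟨0, zero_mem _, by simp⟩
    | add w w' _ _ ih ih' =>
      intro s
      obtain ⟨z, hz, h⟩ := ih s
      obtain ⟨z', hz', h'⟩ := ih' s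
      exact ⟨z + z', add_mem hz hz', by rw [map_add, h, h', mul_add]⟩
    | smul a w _ ih =>
      intro s
      obtain ⟨z, hz, h⟩ := ih (s * a)
      exact ⟨z, hz, by rw [h, smul_eq_mul]; ring⟩
  obtain ⟨z, hz, h⟩ := key g (hg ▸ Ideal.mem_span_singleton_self g) P
  exact ⟨z, hz, by rw [h]; ring⟩

/-- The lattice generates the unit ideal of `F[t]`. -/
theorem eq_top_of_lattice_le {f g : F[X]} (hg0 : g ≠ 0) {I : Ideal (CoordinateRing f)}
    (hg : I.map (normalization f) = Ideal.span {g}) {M : Ideal F[X]}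
    (hM : ∀ j ∈ lattice f I g, j ∈ M) : M = ⊤ := by
  have hle : I.map (normalization f) ≤ Ideal.span {g} * M := by
    rw [Ideal.map_le_iff_le_comap]
    intro z hz
    have hz' : normalization f z ∈ Ideal.span {g} := hg ▸ Ideal.mem_map_of_mem _ hz
    obtain ⟨j, hj⟩ := Ideal.mem_span_singleton.mp hz'
    rw [Ideal.mem_comap, hj]
    exact Ideal.mul_mem_mul (Ideal.mem_span_singleton_self g) (hM j ⟨z, hz, hj⟩)
  have hmem := hle (hg ▸ Ideal.mem_span_singleton_self g : g ∈ I.map (normalization f))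
  obtain ⟨m, hm, hgm⟩ := Ideal.mem_span_singleton_mul.mp hmem
  have : m = 1 := mul_left_cancel₀ hg0 (by rw [hgm, mul_one])
  rw [Ideal.eq_top_iff_one, ← this]
  exact hm

/-- The lattice of an invertible ideal is a proper subset of `F[t]`: otherwise multiplying it by
the lattice of a cofactor, which generates the unit ideal of `F[t]`, would give all of `F[t]`
instead of the coordinate ring. -/
theorem exists_notMem_lattice {f : F[X]} (hf : Irreducible f) {I J : Ideal (CoordinateRing f)}
    {c : CoordinateRing f} (hc : c ≠ 0) (hIJ : I * J = Ideal.span {c}) {g : F[X]}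
    (hg : I.map (normalization f) = Ideal.span {g}) : ∃ P, P ∉ lattice f I g := by
  by_contra! hall
  obtain ⟨g', hg'⟩ := (IsPrincipalIdealRing.principal (J.map (normalization f))).principal
  rw [← Ideal.span] at hg'
  have hc' : normalization f c ≠ 0 :=
    (map_ne_zero_iff _ (normalization_injective hf.ne_zero)).mpr hc
  have hmap := congrArg (Ideal.map (normalization f)) hIJ
  rw [Ideal.map_mul, hg, hg', Ideal.map_span, Set.image_singleton,
    Ideal.span_singleton_mul_span_singleton, Ideal.span_singleton_eq_span_singleton] at hmap
  obtain ⟨u, hu⟩ := hmap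
  have hg'0 : g' ≠ 0 := by
    rintro rfl
    exact hc' (by rw [← hu]; simp)
  have hg0 : g ≠ 0 := by
    rintro rfl
    exact hc' (by rw [← hu]; simp)
  obtain ⟨e, he0, he⟩ := Polynomial.isUnit_iff.mp u.isUnit
  rw [← he] at hu
  have hprod : ∀ j ∈ lattice f J g', ∀ P, P * j ∈ (normalization f).range := by
    rintro j ⟨w, hw, hwj⟩ P
    obtain ⟨z, hz, hzP⟩ := hall P
    have hmem : z * w ∈ Ideal.span {c} := hIJ ▸ Ideal.mul_mem_mul hz hw
    obtain ⟨r, hr⟩ := Ideal.mem_span_singleton.mp hmem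
    refine ⟨AdjoinRoot.of (equation f) (C e) * r, ?_⟩
    have hr' := congrArg (normalization f) hr
    rw [map_mul, map_mul, hzP, hwj, ← hu] at hr'
    rw [map_mul, normalization_of, expand_C]
    exact mul_left_cancel₀ (mul_ne_zero hg0 hg'0) (by linear_combination -hr')
  have htop : Ideal.span {expand F 2 f} = ⊤ := by
    refine eq_top_of_lattice_le hg'0 hg' fun j hj => ?_
    obtain ⟨a, b, rfl⟩ := exists_expand_add_X_mul_expand j
    have h1 : f ∣ b := mem_range_normalization.mp (by simpa using hprod _ hj 1)
    have h2 : f ∣ a := by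
      refine mem_range_normalization (a := X * b).mp ?_
      convert hprod _ hj X using 1
      simp only [map_mul, expand_X]
      ring
    rw [Ideal.mem_span_singleton]
    exact expand_dvd_expand_add h2 h1
  obtain ⟨P, hP⟩ := isUnit_iff_dvd_one.mp (Ideal.span_singleton_eq_top.mp htop)
  obtain ⟨a, b, rfl⟩ := exists_expand_add_X_mul_expand P
  have h1 : expand F 2 1 + X * expand F 2 0 = expand F 2 (f * a) + X * expand F 2 (f * b) := by
    simp only [map_mul, map_one, map_zero, mul_zero, add_zero]
    rw [hP]
    ring
  exact hf.not_isUnit (IsUnit.of_mul_eq_one _ (expand_add_X_mul_expand_inj h1).1.symm)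

/-- A lattice containing a polynomial in `x = t²` prime to `f` contains `1`, because it also
contains `f`. -/
theorem one_mem_lattice {f : F[X]} (hf : Irreducible f) {g : F[X]}
    {I : Ideal (CoordinateRing f)} (hg : I.map (normalization f) = Ideal.span {g}) {a : F[X]}
    (ha : ¬ f ∣ a) (hmem : expand F 2 a ∈ lattice f I g) : (1 : F[X]) ∈ lattice f I g := by
  obtain ⟨u, v, huv⟩ := hf.coprime_iff_not_dvd.mpr ha
  have h1 := add_mem (conductor_mul_mem_lattice hg (expand F 2 u))
    (expand_mul_mem_lattice v hmem)
  convert h1 using 1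
  rw [← map_one (expand F 2), ← huv]
  simp only [map_add, map_mul]
  ring

/-- An invertible ideal is principal or equivalent to the ideal of a pair `[f², h f]` with `h`
admissible: modulo `f`, its lattice is a line in the plane `F[t] / (f(t²))` over `F[x] / (f)`,
spanned either by `1` or by some `t - h`. -/
theorem principal_or_exists_admissible {f : F[X]} (hf : Irreducible f)
    {I J : Ideal (CoordinateRing f)} {c : CoordinateRing f} (hc : c ≠ 0)
    (hIJ : I * J = Ideal.span {c}) :
    (∃ x : CoordinateRing f, x ≠ 0 ∧ I = Ideal.span {x}) ∨
    ∃ h : F[X], h.degree < f.natDegree ∧ IsCoprime f (X - h ^ 2) ∧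
      ∃ x y : CoordinateRing f, x ≠ 0 ∧ y ≠ 0 ∧
        Ideal.span {x} * mumfordIdeal f (f ^ 2) (h * f) = Ideal.span {y} * I := by
  have hf' := expand_ne_zero hf.ne_zero
  have hinj := normalization_injective hf.ne_zero
  obtain ⟨g, hg⟩ := (IsPrincipalIdealRing.principal (I.map (normalization f))).principal
  rw [← Ideal.span] at hg
  have hg0 : g ≠ 0 := by
    rintro rfl
    rw [Ideal.span_singleton_zero, Ideal.map_eq_bot_iff_of_injective hinj] at hg
    rw [hg, Ideal.bot_mul, eq_comm, Ideal.span_singleton_eq_bot] at hIJ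
    exact hc hIJ
  have hdiv : ∀ z ∈ I, ∃ j, normalization f z = g * j := fun z hz =>
    Ideal.mem_span_singleton.mp (hg ▸ Ideal.mem_map_of_mem _ hz)
  by_cases hA : ∀ a b : F[X], expand F 2 a + X * expand F 2 b ∈ lattice f I g → f ∣ b
  · left
    -- Some lattice element has even part prime to `f`, as the lattice is not contained in `(f)`.
    obtain ⟨a, ha, hmem⟩ : ∃ a, ¬ f ∣ a ∧ expand F 2 a ∈ lattice f I g := by
      by_contra! hcon
      have htop : Ideal.span {expand F 2 f} = ⊤ := by
        refine eq_top_of_lattice_le hg0 hg fun j hj => ?_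
        obtain ⟨a, b, rfl⟩ := exists_expand_add_X_mul_expand j
        obtain ⟨b', rfl⟩ := hA a b hj
        have h1 : expand F 2 a ∈ lattice f I g := by
          have := sub_mem hj (conductor_mul_mem_lattice hg (X * expand F 2 b'))
          convert this using 1
          rw [map_mul]
          ring
        have h2 : f ∣ a := by
          by_contra h
          exact hcon a h h1
        rw [Ideal.mem_span_singleton]
        exact expand_dvd_expand_add h2 (dvd_mul_right f b')
      have h1 : (1 : F[X]) ∈ Ideal.span {expand F 2 f} := htop ▸ Submodule.mem_top
      have h2 := hA 0 1 ?_
      · exact hf.not_isUnit (isUnit_of_dvd_one h2)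
      · obtain ⟨P, hP⟩ := Ideal.mem_span_singleton.mp h1
        have := conductor_mul_mem_lattice hg (P * X)
        rw [← mul_assoc, ← hP] at this
        simpa using this
    obtain ⟨z, hz, hzg⟩ := one_mem_lattice hf hg ha hmem
    rw [mul_one] at hzg
    refine ⟨z, fun h => hg0 (by rw [← hzg, h, map_zero]), le_antisymm ?_ ?_⟩
    · intro w hw
      obtain ⟨j, hj⟩ := hdiv w hw
      obtain ⟨a, b, rfl⟩ := exists_expand_add_X_mul_expand j
      obtain ⟨r, hr⟩ := (mem_range_normalization (a := a)).mpr (hA a b ⟨w, hw, hj⟩)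
      rw [Ideal.mem_span_singleton]
      exact ⟨r, hinj (by rw [map_mul, hj, hzg, hr])⟩
    · rwa [Ideal.span_singleton_le_iff_mem]
  · right
    -- Scale a lattice element with odd part prime to `f` to `t - h` modulo `f`, and reduce `h`.
    push Not at hA
    obtain ⟨a, b, hab, hb⟩ := hA
    obtain ⟨u, v, huv⟩ := hf.coprime_iff_not_dvd.mpr hb
    set h : F[X] := -(v * a) % f
    have hdeg : h.degree < f.natDegree := by
      rw [← degree_eq_natDegree hf.ne_zero]
      exact degree_mod_lt _ hf.ne_zero
    have hmod : -(v * a) = f * (-(v * a) / f) + h := (EuclideanDomain.div_add_mod _ f).symm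
    have hth : X - expand F 2 h ∈ lattice f I g := by
      have h1 := add_mem (expand_mul_mem_lattice v hab)
        (conductor_mul_mem_lattice hg
          (X * expand F 2 u + expand F 2 (-(v * a) / f)))
      convert h1 using 1
      have e1 := congrArg (expand F 2) huv
      have e2 := congrArg (expand F 2) hmod
      simp only [map_add, map_mul, map_one, map_neg] at e1 e2
      linear_combination -X * e1 + e2
    -- With `t - h`, the element `1` would span all of `F[t]` over `F[x]`.
    have hone : (1 : F[X]) ∉ lattice f I g := by
      intro h1
      obtain ⟨P, hP⟩ := exists_notMem_lattice hf hc hIJ hg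
      apply hP
      obtain ⟨p, q, rfl⟩ := exists_expand_add_X_mul_expand P
      have h2 := add_mem (expand_mul_mem_lattice (p + q * h) h1) (expand_mul_mem_lattice q hth)
      convert h2 using 1
      simp only [map_add, map_mul]
      ring
    have hlat : ∀ j, j ∈ lattice f I g ↔ ∃ p q : F[X],
        j = expand F 2 p * expand F 2 f + expand F 2 q * (X - expand F 2 h) := by
      intro j
      constructor
      · intro hj
        obtain ⟨p, q, rfl⟩ := exists_expand_add_X_mul_expand j
        have h1 : expand F 2 (p + q * h) ∈ lattice f I g := by
          convert sub_mem hj (expand_mul_mem_lattice q hth) using 1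
          simp only [map_add, map_mul]
          ring
        have h2 : f ∣ p + q * h := by
          by_contra hcon
          exact hone (one_mem_lattice hf hg hcon h1)
        obtain ⟨e, he⟩ := h2
        refine ⟨e, q, ?_⟩
        have := congrArg (expand F 2) he
        simp only [map_add, map_mul] at this
        linear_combination this
      · rintro ⟨p, q, rfl⟩
        refine add_mem ?_ (expand_mul_mem_lattice q hth)
        rw [mul_comm]
        exact conductor_mul_mem_lattice hg _
    have hcop : IsCoprime (expand F 2 f) (X - expand F 2 h) := by
      rw [← Ideal.isCoprime_span_singleton_iff, Ideal.isCoprime_iff_sup_eq,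
        ← Ideal.span_union, Set.singleton_union]
      refine eq_top_of_lattice_le hg0 hg fun j hj => ?_
      obtain ⟨p, q, rfl⟩ := (hlat j).mp hj
      exact Ideal.mem_span_pair.mpr ⟨_, _, rfl⟩
    refine ⟨h, hdeg, isCoprime_of_isCoprime_expand hf hcop, ?_⟩
    -- `g` need not lie in the coordinate ring, but its conductor multiple `f g` does.
    obtain ⟨x, hx⟩ := expand_mul_mem_range_normalization f g
    refine ⟨x, AdjoinRoot.of (equation f) (f ^ 2), ?_, ?_, ?_⟩
    · rintro rfl
      rw [map_zero] at hx
      exact mul_ne_zero hf' hg0 hx.symm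
    · intro h0
      have := congrArg (normalization f) h0
      rw [normalization_of, map_pow, map_zero] at this
      exact pow_ne_zero 2 hf' this
    · apply le_antisymm
      · rw [Ideal.span_singleton_mul_le_span_singleton_mul]
        intro z hz
        obtain ⟨p, q, hpq⟩ := (mem_mumfordIdeal_iff hf.ne_zero h).mp hz
        obtain ⟨w, hw, hwj⟩ := (hlat _).mpr ⟨p, q, rfl⟩
        refine ⟨w, hw, hinj ?_⟩
        rw [map_mul, map_mul, hx, hpq, hwj, normalization_of, map_pow]
        ring
      · rw [Ideal.span_singleton_mul_le_span_singleton_mul]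
        intro w hw
        obtain ⟨j, hj⟩ := hdiv w hw
        obtain ⟨p, q, hpq⟩ := (hlat j).mp ⟨w, hw, hj⟩
        obtain ⟨z, hz⟩ := expand_mul_mem_range_normalization f j
        refine ⟨z, (mem_mumfordIdeal_iff hf.ne_zero h).mpr ⟨p, q, by rw [hz, hpq]⟩, hinj ?_⟩
        rw [map_mul, map_mul, hx, hj, hz, normalization_of, map_pow]
        ring

/-! ### Classes of Mumford pairs -/

theorem exists_unit_eq_mumfordIdeal {f : F[X]} [hf : Fact (Irreducible f)] {h : F[X]}
    (hh : IsCoprime f (X - h ^ 2)) :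
    ∃ K : (FractionalIdeal (CoordinateRing f)⁰ (FractionRing (CoordinateRing f)))ˣ,
      (K : FractionalIdeal (CoordinateRing f)⁰ (FractionRing (CoordinateRing f))) =
        (mumfordIdeal f (f ^ 2) (h * f) :
          FractionalIdeal (CoordinateRing f)⁰ (FractionRing (CoordinateRing f))) := by
  refine exists_unit_eq_coeIdeal_of_mul_eq_span ?_ (mumfordIdeal_mul_mumfordIdeal_neg hh)
  intro h0
  have := congrArg (normalization f) h0
  rw [normalization_of, map_pow, map_zero] at this
  exact pow_ne_zero 2 (expand_ne_zero hf.out.ne_zero) this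

theorem represents_one {f : F[X]} [Fact (Irreducible f)] : Represents f 1 0 1 := by
  refine ⟨⟨by simp, rhs f, by ring, fun a _ h1 => by simp at h1⟩, 1, ?_, map_one _⟩
  have htop : mumfordIdeal f 1 0 = ⊤ := by
    rw [Ideal.eq_top_iff_one, ← map_one (AdjoinRoot.of (equation f))]
    exact Ideal.subset_span (Set.mem_insert _ _)
  rw [htop, FractionalIdeal.coeIdeal_top, Units.val_one]

end NodalCurve

open NodalCurve in
theorem theorem1 {F : Type*} [Field F] [Finite F] (hF : ringChar F ≠ 2)
    (f : F[X]) [Fact (Irreducible f)] (d : ℕ) (hd : f.natDegree = d) :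
    -- every admissible `h` represents, through the pair `[f², h f]`, one class, not the identity
    (∀ h : F[X], h.degree < d → IsCoprime f (X - h ^ 2) →
      (∃! D : NodalCurve.Jac f, NodalCurve.Represents f (f ^ 2) (h * f) D) ∧
      ¬ NodalCurve.Represents f (f ^ 2) (h * f) 1) ∧
    -- every class other than the identity is represented by exactly one admissible `h`
    (∀ D : NodalCurve.Jac f, D ≠ 1 →
      ∃! h : F[X], h.degree < d ∧ IsCoprime f (X - h ^ 2) ∧
        NodalCurve.Represents f (f ^ 2) (h * f) D) ∧
    -- the identity is represented by the pair `[1, 0]`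
    NodalCurve.Represents f 1 0 1 := by
  have hf : Irreducible f := Fact.out
  subst hd
  refine ⟨fun h hdeg hh => ⟨?_, ?_⟩, fun D hD => ?_, represents_one⟩
  · obtain ⟨K, hK⟩ := exists_unit_eq_mumfordIdeal hh
    refine ⟨_, ⟨isMumfordPair_of_isCoprime hf.ne_zero hdeg hh, K, hK, rfl⟩, ?_⟩
    rintro _ ⟨-, K', hK', rfl⟩
    rw [Units.ext (hK'.trans hK.symm)]
  · rintro ⟨-, K, hK, hK1⟩
    obtain ⟨x, -, hx⟩ := (ClassGroup.mk_eq_one_of_coe_ideal hK).mp hK1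
    exact not_mumfordIdeal_eq_span hf hh x hx
  · obtain ⟨K, I, J, c, hc, hKI, rfl, hIJ⟩ := exists_coeIdeal_of_class D
    rcases principal_or_exists_admissible hf hc hIJ with hprin | ⟨h, hdeg, hh, hxy⟩
    · exact absurd ((ClassGroup.mk_eq_one_of_coe_ideal hKI).mpr hprin) hD
    · obtain ⟨L, hL⟩ := exists_unit_eq_mumfordIdeal hh
      have hLK := (ClassGroup.mk_eq_mk_of_coe_ideal hL hKI).mpr hxy
      refine ⟨h, ⟨hdeg, hh, isMumfordPair_of_isCoprime hf.ne_zero hdeg hh, L, hL, hLK⟩, ?_⟩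
      rintro k ⟨hkdeg, hk, -, M, hM, hMK⟩
      obtain ⟨x, y, hx, -, heq⟩ :=
        (ClassGroup.mk_eq_mk_of_coe_ideal hM hL).mp (hMK.trans hLK.symm)
      exact eq_of_span_mul_mumfordIdeal_eq hf.ne_zero hkdeg hdeg hk hh hx heq
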